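/- A gauge function is a monotone increasing (i.e. non-decreasing), right continuous function $g:[0,\infty)\to[0,\infty)$. For $A\subset\mathbb{R}$, the Hausdorff measure with gauge function $g$ is $$\mathcal{H}^g(A)=\lim_{\delta\to 0+}\inf\Big\{\sum_{i} g(\operatorname{diam} U_i) : A\subset \bigcup_{i} U_i,\ \operatorname{diam} U_i<\delta\Big\},$$ where the infimum is over countable (finite or infinite) covers of $A$ by non-empty sets $U_i$. A Borel set $B\subset\mathbb{R}$ is measured by a Borel measure $\mu$ on $\mathbb{R}$ if $\mu(B)>0$ and $\mu$ is $\sigma$-finite on $B$, i.e. $B$ is a countable union of Borel sets of finite $\mu$-measure. A Borel measure $\mu$ on $\mathbb{R}$ is translation invariant if $\mu(B+t)=\mu(B)$ for all Borel sets $B\subset\mathbb{R}$ and all $t\in\mathbb{R}$. Theorem. There is a compact set $K\subset\mathbb{R}$ which is measured by some translation invariant Borel measure on $\mathbb{R}$, but which is not measured by any Hausdorff measure; that is, for every gauge function $g$, either $\mathcal{H}^g(K)=0$ or $\mathcal{H}^g$ is not $\sigma$-finite on $K$. -/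

import Mathlib

open MeasureTheory
open scoped NNReal ENNReal

/-- A gauge function: a monotone (non-decreasing), right continuous function `[0,∞) → [0,∞)`.
Neither strict monotonicity nor `g 0 = 0` is required. -/
structure IsGauge (g : ℝ≥0 → ℝ≥0) : Prop where
  monotone : Monotone g
  right_continuous : ∀ x, ContinuousWithinAt g (Set.Ici x) x

/-- The Hausdorff measure `H^g` on the Borel sets of `ℝ`: the limit, as `δ → 0+`, of the infimum of
`∑ g (diam Uᵢ)` over countable covers by sets of diameter at most `δ`, where empty covering sets
contribute `0` (see `MeasureTheory.Measure.mkMetric_apply`). The value assigned here to sets of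
infinite diameter plays no role, because only small `δ` matter. -/
noncomputable def gaugeHausdorff (g : ℝ≥0 → ℝ≥0) : Measure ℝ :=
  Measure.mkMetric fun d : ℝ≥0∞ => (g d.toNNReal : ℝ≥0∞)

/-- The set `B` is measured by `μ`: it is Borel, and `μ` is positive and `σ`-finite on `B`. -/
def IsMeasuredBy (B : Set ℝ) (μ : Measure ℝ) : Prop :=
  MeasurableSet B ∧ 0 < μ B ∧ SigmaFinite (μ.restrict B)

open Topology

/-! Embed binary sequences in the line with their bits and pairwise products as decimal digits. A
non-zero difference of two points then determines both, so `colourCantor` meets each proper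
translate in at most one point. Summing all translates of an atomless probability on it gives an
invariant measure with value 1 there.

For a gauge `g`, countably many pieces `colourPiece n b` cover the sequences in `colourSet`, so if
the Hausdorff measure is positive, some piece has an image of positive measure. Colour `n + 1` is
unused in that piece; filling it with arbitrary `w` (`recolour`) gives uncountably many disjoint
copies inside the compact set. Each copy maps back onto the piece by a 2-Lipschitz map, so each has
positive measure, which σ-finiteness forbids. -/

/-! ### Hausdorff measures and Lipschitz maps -/

/-- A bounded subset of the line is the union of two sets of at most half its diameter. -/
theorem exists_union_abs_sub_le_half_diam (s : Set ℝ) (hs : Bornology.IsBounded s) :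
    ∃ s₁ s₂ : Set ℝ, s = s₁ ∪ s₂ ∧
      (∀ p ∈ s₁, ∀ q ∈ s₁, 2 * |p - q| ≤ Metric.diam s) ∧
      (∀ p ∈ s₂, ∀ q ∈ s₂, 2 * |p - q| ≤ Metric.diam s) := by
  have hlow : ∀ p ∈ s, sInf s ≤ p := fun p hp => csInf_le hs.bddBelow hp
  have hup : ∀ p ∈ s, p ≤ sInf s + Metric.diam s := fun p hp => by
    have : p - Metric.diam s ≤ sInf s := le_csInf ⟨p, hp⟩ fun q hq => by
      have := Metric.dist_le_diam_of_mem hs hp hq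
      rw [Real.dist_eq] at this
      linarith [le_abs_self (p - q)]
    linarith
  set c := sInf s + Metric.diam s / 2 with hc
  refine ⟨s ∩ Set.Iic c, s ∩ Set.Ici c, ?_, ?_, ?_⟩
  · rw [← Set.inter_union_distrib_left, Set.Iic_union_Ici, Set.inter_univ]
  · rintro p ⟨hp, hpc⟩ q ⟨hq, hqc⟩
    rw [Set.mem_Iic] at hpc hqc
    have : |p - q| ≤ Metric.diam s / 2 :=
      abs_le.2 ⟨by linarith [hlow p hp], by linarith [hlow q hq]⟩
    linarith
  · rintro p ⟨hp, hpc⟩ q ⟨hq, hqc⟩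
    rw [Set.mem_Ici] at hpc hqc
    have : |p - q| ≤ Metric.diam s / 2 :=
      abs_le.2 ⟨by linarith [hup q hq], by linarith [hup p hp]⟩
    linarith

/-- If `v` is `2`-Lipschitz with respect to `u`, then passing from the image of `u` to that of `v`
at most doubles the metric outer measure of any monotone function of the diameter. -/
theorem mkMetric_image_le_two_mul {α : Type*} {m : ℝ≥0∞ → ℝ≥0∞} (hm : Monotone m)
    {u v : α → ℝ} {S : Set α}
    (h : ∀ x ∈ S, ∀ y ∈ S, |v x - v y| ≤ 2 * |u x - u y|) :
    (OuterMeasure.mkMetric m : OuterMeasure ℝ) (v '' S) ≤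
      2 * (OuterMeasure.mkMetric m : OuterMeasure ℝ) (u '' S) := by
  have key : ∀ r : ℝ≥0∞, 0 < r → r ≤ 1 →
      OuterMeasure.mkMetric'.pre (fun s : Set ℝ => m (Metric.ediam s)) r (v '' S) ≤
        2 * (OuterMeasure.mkMetric m : OuterMeasure ℝ) (u '' S) := by
    intro r hr hr1
    set P : OuterMeasure ℝ := OuterMeasure.mkMetric'.pre (fun s : Set ℝ => m (Metric.ediam s)) r
    set μ : OuterMeasure ℝ :=
      OuterMeasure.map u (OuterMeasure.restrict S (OuterMeasure.comap v P)) with hμ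
    have hμs : ∀ s, μ s = P (v '' (u ⁻¹' s ∩ S)) := fun s => by
      simp [hμ]
    have hle : μ ≤ OuterMeasure.mkMetric ((2 : ℝ≥0∞) • m) := by
      refine OuterMeasure.le_mkMetric _ _ r hr fun s hs => ?_
      have hfin : Metric.ediam s ≠ ∞ := (hs.trans_lt (hr1.trans_lt ENNReal.one_lt_top)).ne
      -- Halving first means that the images have diameter at most that of `s`, so no doubling
      -- condition on `m` is needed; the price is a factor 2 in front.
      obtain ⟨s₁, s₂, hs12, h₁, h₂⟩ := exists_union_abs_sub_le_half_diam s
        (Metric.isBounded_iff_ediam_ne_top.2 hfin)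
      have piece : ∀ t : Set ℝ, (∀ p ∈ t, ∀ q ∈ t, 2 * |p - q| ≤ Metric.diam s) →
          P (v '' (u ⁻¹' t ∩ S)) ≤ m (Metric.ediam s) := by
        intro t ht
        have hd : Metric.ediam (v '' (u ⁻¹' t ∩ S)) ≤ Metric.ediam s := by
          refine Metric.ediam_le ?_
          rintro _ ⟨x, ⟨hx, hxS⟩, rfl⟩ _ ⟨y, ⟨hy, hyS⟩, rfl⟩
          rw [edist_dist, Real.dist_eq]
          refine ENNReal.ofReal_le_of_le_toReal ?_
          exact (h x hxS y hyS).trans (ht _ hx _ hy)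
        exact (OuterMeasure.mkMetric'.pre_le (hd.trans hs)).trans (hm hd)
      rw [hμs, hs12, Set.preimage_union, Set.union_inter_distrib_right, Set.image_union, ← hs12]
      calc _ ≤ _ := measure_union_le _ _
        _ ≤ m (Metric.ediam s) + m (Metric.ediam s) := add_le_add (piece _ h₁) (piece _ h₂)
        _ = _ := by simp [two_mul]
    rw [OuterMeasure.mkMetric_smul m (by simp) (by simp)] at hle
    have := hle (u '' S)
    rw [hμs] at this
    exact le_trans (measure_mono (Set.image_mono
      (Set.subset_inter (Set.subset_preimage_image u S) subset_rfl))) this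
  rw [OuterMeasure.mkMetric, OuterMeasure.mkMetric']
  simp only [OuterMeasure.iSup_apply]
  refine iSup₂_le fun r hr => ?_
  refine (OuterMeasure.mkMetric'.mono_pre _ (min_le_left r 1) _).trans ?_
  have := key (min r 1) (lt_min hr one_pos) (min_le_right _ _)
  simpa only [OuterMeasure.mkMetric, OuterMeasure.mkMetric', OuterMeasure.iSup_apply] using this

theorem gaugeHausdorff_image_eq_zero {α : Type*} {g : ℝ≥0 → ℝ≥0} (hg : IsGauge g)
    {u v : α → ℝ} {S : Set α}
    (h : ∀ x ∈ S, ∀ y ∈ S, |v x - v y| ≤ 2 * |u x - u y|)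
    (h0 : gaugeHausdorff g (u '' S) = 0) : gaugeHausdorff g (v '' S) = 0 := by
  -- Since `toNNReal` sends `∞` to `0`, the original function of the diameter may fail to be
  -- monotone. Truncating at 1 repairs this and changes nothing near 0.
  let g' : ℝ≥0∞ → ℝ≥0∞ := fun d => (g (min d 1).toNNReal : ℝ≥0∞)
  have hmono : Monotone g' := fun d e hde => by
    refine ENNReal.coe_le_coe.2 (hg.monotone (ENNReal.toNNReal_mono ?_ (min_le_min_right 1 hde)))
    exact ((min_le_right _ _).trans_lt ENNReal.one_lt_top).ne
  have heq : (OuterMeasure.mkMetric fun d : ℝ≥0∞ => (g d.toNNReal : ℝ≥0∞)) =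
      (OuterMeasure.mkMetric g' : OuterMeasure ℝ) := by
    have hev : ∀ᶠ d : ℝ≥0∞ in 𝓝 0, (g d.toNNReal : ℝ≥0∞) = g' d := by
      filter_upwards [Iio_mem_nhds (zero_lt_one (α := ℝ≥0∞))] with d hd
      simp only [g', min_eq_left (le_of_lt (Set.mem_Iio.1 hd))]
    exact le_antisymm (OuterMeasure.mkMetric_mono (hev.mono fun _ h => h.le))
      (OuterMeasure.mkMetric_mono (hev.mono fun _ h => h.ge))
  rw [gaugeHausdorff, ← Measure.coe_toOuterMeasure, Measure.mkMetric_toOuterMeasure, heq] at h0 ⊢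
  have := mkMetric_image_le_two_mul hmono h
  rwa [h0, mul_zero, nonpos_iff_eq_zero] at this

/-! ### Decimal expansions -/

theorem summable_mul_tenth_pow {c : ℕ → ℝ} {M : ℝ} (hc : ∀ n, |c n| ≤ M) :
    Summable fun n => c n * (1 / 10 : ℝ) ^ n := by
  refine Summable.of_norm_bounded
    ((summable_geometric_of_lt_one (by norm_num) (by norm_num : (1 / 10 : ℝ) < 1)).mul_left M)
    fun n => ?_
  rw [norm_mul, Real.norm_eq_abs, Real.norm_of_nonneg (by positivity)]
  gcongr
  exact hc n

/-- A decimal expansion with bounded digits is close to its leading term. -/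
theorem abs_tsum_sub_leading_le {c : ℕ → ℝ} {M : ℝ} (hc : ∀ n, |c n| ≤ M) {N : ℕ}
    (h0 : ∀ n < N, c n = 0) :
    |∑' n, c n * (1 / 10 : ℝ) ^ n - c N * (1 / 10 : ℝ) ^ N| ≤ M / 9 * (1 / 10 : ℝ) ^ N := by
  have hsum := summable_mul_tenth_pow hc
  rw [← hsum.sum_add_tsum_nat_add (N + 1), Finset.sum_range_succ,
    Finset.sum_eq_zero fun n hn => by rw [h0 n (Finset.mem_range.1 hn), zero_mul], zero_add,
    add_sub_cancel_left, ← Real.norm_eq_abs]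
  have hgeo : HasSum (fun n : ℕ => M * (1 / 10 : ℝ) ^ (N + 1) * (1 / 10 : ℝ) ^ n)
      (M / 9 * (1 / 10 : ℝ) ^ N) := by
    have := (hasSum_geometric_of_lt_one (by norm_num) (by norm_num : (1 / 10 : ℝ) < 1)).mul_left
      (M * (1 / 10 : ℝ) ^ (N + 1))
    rwa [show M * (1 / 10 : ℝ) ^ (N + 1) * (1 - 1 / 10)⁻¹ = M / 9 * (1 / 10 : ℝ) ^ N by
      rw [pow_succ]; norm_num; ring] at this
  refine tsum_of_norm_bounded hgeo fun n => ?_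
  rw [norm_mul, Real.norm_eq_abs, Real.norm_of_nonneg (by positivity), pow_add, mul_comm (_ ^ n),
    mul_assoc]
  gcongr
  exact hc _

/-- A decimal expansion with integer digits bounded by `2` vanishes only if all digits vanish. -/
theorem eq_zero_of_tsum_eq_zero {c : ℕ → ℤ} (hc : ∀ n, |c n| ≤ 2)
    (h : ∑' n, (c n : ℝ) * (1 / 10 : ℝ) ^ n = 0) (n : ℕ) : c n = 0 := by
  induction n using Nat.strong_induction_on with
  | _ N ih =>
    have := abs_tsum_sub_leading_le (c := fun n => (c n : ℝ)) (M := 2)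
      (fun n => by exact_mod_cast hc n) (N := N) (fun n hn => by simp [ih n hn])
    rw [h, zero_sub, abs_neg, abs_mul, abs_of_pos (by positivity : (0 : ℝ) < (1 / 10) ^ N)] at this
    have h1 : |(c N : ℝ)| ≤ 2 / 9 := le_of_mul_le_mul_right this (by positivity)
    have h2 : |(c N : ℝ)| < 1 := by linarith
    have h3 : |c N| < 1 := by exact_mod_cast h2
    exact Int.abs_lt_one_iff.1 h3

/-! ### The embedding of the Cantor space -/

/-- The `n`-th decimal digit of the embedded point `x`: the bit `x b` if `n = Nat.pair 0 b`, and the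
product of the bits `x a` and `x b` if `n = Nat.pair (a + 1) b`. -/
def quadDigit (n : ℕ) (x : ℕ → Bool) : ℤ :=
  if (n.unpair.1 = 0 ∨ x (n.unpair.1 - 1) = true) ∧ x n.unpair.2 = true then 1 else 0

/-- The embedding of the Cantor space in the line whose decimal digits are the bits of `x` and their
pairwise products. -/
noncomputable def quadEmbed (x : ℕ → Bool) : ℝ :=
  ∑' n, (quadDigit n x : ℝ) * (1 / 10 : ℝ) ^ n

theorem quadDigit_pair_zero (b : ℕ) (x : ℕ → Bool) :
    quadDigit (Nat.pair 0 b) x = if x b = true then 1 else 0 := by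
  simp [quadDigit]

theorem quadDigit_pair_succ (a b : ℕ) (x : ℕ → Bool) :
    quadDigit (Nat.pair (a + 1) b) x = if x a = true ∧ x b = true then 1 else 0 := by
  simp [quadDigit]

theorem quadDigit_mem (n : ℕ) (x : ℕ → Bool) : quadDigit n x = 0 ∨ quadDigit n x = 1 := by
  unfold quadDigit
  split_ifs <;> simp

theorem abs_quadDigit_le (n : ℕ) (x : ℕ → Bool) : |(quadDigit n x : ℝ)| ≤ 1 := by
  rcases quadDigit_mem n x with h | h <;> simp [h]

theorem continuous_quadEmbed : Continuous quadEmbed := by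
  refine continuous_tsum (u := fun n => (1 / 10 : ℝ) ^ n) (fun n => ?_)
    (summable_geometric_of_lt_one (by norm_num) (by norm_num)) fun n x => ?_
  · refine Continuous.mul ?_ continuous_const
    have : (fun x => (quadDigit n x : ℝ)) =
        (fun p : Bool × Bool => (((if (n.unpair.1 = 0 ∨ p.1 = true) ∧ p.2 = true
          then 1 else 0 : ℤ)) : ℝ)) ∘ fun x => (x (n.unpair.1 - 1), x n.unpair.2) := rfl
    rw [this]
    exact continuous_of_discreteTopology.comp (by fun_prop)
  · rw [norm_mul, Real.norm_eq_abs, Real.norm_of_nonneg (by positivity)]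
    exact mul_le_of_le_one_left (by positivity) (abs_quadDigit_le n x)

theorem quadEmbed_sub (x y : ℕ → Bool) :
    quadEmbed x - quadEmbed y =
      ∑' n, ((quadDigit n x : ℝ) - quadDigit n y) * (1 / 10 : ℝ) ^ n := by
  simp_rw [sub_mul]
  exact ((summable_mul_tenth_pow fun n => abs_quadDigit_le n x).tsum_sub
    (summable_mul_tenth_pow fun n => abs_quadDigit_le n y)).symm

/-- Digits before position `Nat.pair 0 k` only depend on bits before position `k`. -/
theorem quadDigit_congr {x y : ℕ → Bool} {k n : ℕ} (h : ∀ i < k, x i = y i)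
    (hn : n < Nat.pair 0 k) : quadDigit n x = quadDigit n y := by
  -- Pairs are enumerated by increasing maximum, and `Nat.pair 0 k = k ^ 2` is the first code with
  -- maximum `k`.
  have hmax : max n.unpair.1 n.unpair.2 < k := by
    by_contra hk
    have h1 : k ^ 2 ≤ max n.unpair.1 n.unpair.2 ^ 2 := Nat.pow_le_pow_left (not_lt.1 hk) 2
    have h2 := Nat.max_sq_add_min_le_pair n.unpair.1 n.unpair.2
    rw [Nat.pair_unpair] at h2
    have h3 : Nat.pair 0 k = k ^ 2 := by
      rcases Nat.eq_zero_or_pos k with rfl | hk0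
      · rfl
      · simp [Nat.pair, hk0, sq]
    omega
  unfold quadDigit
  rw [h _ (lt_of_le_of_lt ((Nat.sub_le _ _).trans (le_max_left _ _)) hmax),
    h _ (lt_of_le_of_lt (le_max_right _ _) hmax)]

/-- The distance of two embedded points is determined by their first different bit, up to a
factor. -/
theorem abs_quadEmbed_sub {x y : ℕ → Bool} {k : ℕ} (h : ∀ i < k, x i = y i) (hk : x k ≠ y k) :
    8 / 9 * (1 / 10 : ℝ) ^ Nat.pair 0 k ≤ |quadEmbed x - quadEmbed y| ∧
      |quadEmbed x - quadEmbed y| ≤ 10 / 9 * (1 / 10 : ℝ) ^ Nat.pair 0 k := by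
  have hM : ∀ n, |(quadDigit n x : ℝ) - quadDigit n y| ≤ 1 := fun n => by
    rcases quadDigit_mem n x with h | h <;> rcases quadDigit_mem n y with h' | h' <;> simp [h, h']
  have hlead : |(quadDigit (Nat.pair 0 k) x : ℝ) - quadDigit (Nat.pair 0 k) y| = 1 := by
    rw [quadDigit_pair_zero, quadDigit_pair_zero]
    cases hx : x k <;> cases hy : y k <;> simp_all
  have := abs_tsum_sub_leading_le hM (N := Nat.pair 0 k)
    fun n hn => by rw [quadDigit_congr h hn, sub_self]
  rw [← quadEmbed_sub] at this
  set t := (1 / 10 : ℝ) ^ Nat.pair 0 k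
  have hpos : 0 < t := by positivity
  set L := (quadDigit (Nat.pair 0 k) x : ℝ) - quadDigit (Nat.pair 0 k) y
  have hL : |L * t| = t := by rw [abs_mul, hlead, one_mul, abs_of_pos hpos]
  have h1 := abs_sub_abs_le_abs_sub (quadEmbed x - quadEmbed y) (L * t)
  have h2 := abs_sub_abs_le_abs_sub (L * t) (quadEmbed x - quadEmbed y)
  rw [abs_sub_comm (L * t)] at h2
  constructor <;> linarith

theorem exists_first_ne {x y : ℕ → Bool} (h : x ≠ y) : ∃ k, (∀ i < k, x i = y i) ∧ x k ≠ y k := by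
  classical
  have hex : ∃ k, x k ≠ y k := Function.ne_iff.1 h
  exact ⟨Nat.find hex, fun i hi => not_not.1 (Nat.find_min hex hi), Nat.find_spec hex⟩

theorem quadEmbed_injective : Function.Injective quadEmbed := by
  intro x y hxy
  by_contra hne
  obtain ⟨k, h, hk⟩ := exists_first_ne hne
  have := (abs_quadEmbed_sub h hk).1
  rw [hxy, sub_self, abs_zero] at this
  have hpos : 0 < 8 / 9 * (1 / 10 : ℝ) ^ Nat.pair 0 k := by positivity
  linarith

/-- A non-zero difference of two embedded points determines the two points. -/
theorem eq_of_quadEmbed_sub_eq {x y x' y' : ℕ → Bool} (hne : x ≠ y)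
    (h : quadEmbed x - quadEmbed y = quadEmbed x' - quadEmbed y') : x = x' := by
  have hdig : ∀ n, quadDigit n x - quadDigit n y - (quadDigit n x' - quadDigit n y') = 0 := by
    refine eq_zero_of_tsum_eq_zero (fun n => ?_) ?_
    · rcases quadDigit_mem n x with h1 | h1 <;> rcases quadDigit_mem n y with h2 | h2 <;>
        rcases quadDigit_mem n x' with h3 | h3 <;> rcases quadDigit_mem n y' with h4 | h4 <;>
        simp [h1, h2, h3, h4]
    · have hs : ∀ z w : ℕ → Bool,
          Summable fun n => ((quadDigit n z : ℝ) - quadDigit n w) * (1 / 10 : ℝ) ^ n := fun z w => by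
        simp_rw [sub_mul]
        exact (summable_mul_tenth_pow fun n => abs_quadDigit_le n z).sub
          (summable_mul_tenth_pow fun n => abs_quadDigit_le n w)
      push_cast
      simp_rw [sub_mul _ _ ((1 / 10 : ℝ) ^ _)] at hs ⊢
      rw [(hs x y).tsum_sub (hs x' y')]
      simp_rw [← sub_mul]
      rw [← quadEmbed_sub, ← quadEmbed_sub, h, sub_self]
  -- Bit `k` is set in exactly one of `x`, `y`, and in the corresponding one of `x'`, `y'`. The
  -- products with bit `k` then read off all bits of that sequence.
  obtain ⟨k, hk⟩ := Function.ne_iff.1 hne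
  have hk0 := hdig (Nat.pair 0 k)
  simp only [quadDigit_pair_zero] at hk0
  have hpair := fun j => hdig (Nat.pair (k + 1) j)
  simp only [quadDigit_pair_succ] at hpair
  cases hx : x k
  · have hy : y k = true := by cases hy : y k <;> simp_all
    have hx' : x' k = false := by cases h1 : x' k <;> cases h2 : y' k <;> simp_all
    have hy' : y' k = true := by cases h2 : y' k <;> simp_all
    have hyy : y = y' := by
      funext j
      have := hpair j
      cases h1 : y j <;> cases h2 : y' j <;> simp_all
    apply quadEmbed_injective
    rw [hyy] at h
    linarith
  · have hy : y k = false := by cases hy : y k <;> simp_all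
    have hx' : x' k = true := by cases h1 : x' k <;> cases h2 : y' k <;> simp_all
    have hy' : y' k = false := by cases h2 : y' k <;> simp_all
    funext j
    have := hpair j
    cases h1 : x j <;> cases h2 : x' j <;> simp_all

/-! ### The compact set -/

/-- The sequences in which the colour `k.unpair.1` of any bit `k` that is set is at most the
position of the first bit that is set. -/
def colourSet : Set (ℕ → Bool) :=
  {x | ∀ k j, x k = true → x j = true → k.unpair.1 ≤ j}

/-- The sequences with `n`-th bit `b`, in which the bits that are set have colour at most `n` and
position at least `n`. -/
def colourPiece (n : ℕ) (b : Bool) : Set (ℕ → Bool) :=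
  {x | x n = b ∧ ∀ k, x k = true → k.unpair.1 ≤ n ∧ n ≤ k}

theorem isClosed_colourSet : IsClosed colourSet := by
  simp only [colourSet, Set.ofPred_forall]
  refine isClosed_iInter fun k => isClosed_iInter fun j => ?_
  have : IsClosed ((fun x : ℕ → Bool => (x k, x j)) ⁻¹'
      {p | p.1 = true → p.2 = true → k.unpair.1 ≤ j}) :=
    (isClosed_discrete _).preimage (by fun_prop)
  exact this

theorem isClosed_colourPiece (n : ℕ) (b : Bool) : IsClosed (colourPiece n b) := by
  simp only [colourPiece, Set.ofPred_and, Set.ofPred_forall]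
  refine IsClosed.inter (isClosed_eq (continuous_apply n) continuous_const)
    (isClosed_iInter fun k => ?_)
  have : IsClosed ((fun x : ℕ → Bool => x k) ⁻¹' {p | p = true → k.unpair.1 ≤ n ∧ n ≤ k}) :=
    (isClosed_discrete _).preimage (continuous_apply k)
  exact this

theorem colourSet_subset_iUnion : colourSet ⊆ ⋃ p : ℕ × Bool, colourPiece p.1 p.2 := by
  classical
  intro x hx
  rw [Set.mem_iUnion]
  by_cases hex : ∃ k, x k = true
  · refine ⟨(Nat.find hex, true), Nat.find_spec hex, fun k hk => ⟨?_, Nat.find_min' hex hk⟩⟩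
    exact hx k _ hk (Nat.find_spec hex)
  · push Not at hex
    exact ⟨(0, false), by simpa using hex 0, fun k hk => absurd hk (hex k)⟩

/-- Clear the `n`-th bit of `x` and replace the bits of colour `n + 1` by `w`. -/
def recolour (n : ℕ) (w x : ℕ → Bool) : ℕ → Bool := fun k =>
  if k.unpair.1 = n + 1 then w k.unpair.2 else if k = n then false else x k

theorem continuous_recolour (n : ℕ) (w : ℕ → Bool) : Continuous (recolour n w) := by
  refine continuous_pi fun k => ?_
  unfold recolour
  split_ifs <;> fun_prop

/-- Clearing bit `n` moves every set bit to a position at least `n + 1`, which makes room for colour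
`n + 1`; bits of that colour never lie earlier. -/
theorem recolour_mem {n : ℕ} {b : Bool} (w : ℕ → Bool) {x : ℕ → Bool} (hx : x ∈ colourPiece n b) :
    recolour n w x ∈ colourSet := by
  have key : ∀ k, recolour n w x k = true → k.unpair.1 ≤ n + 1 ∧ n + 1 ≤ k := by
    intro k hk
    unfold recolour at hk
    split_ifs at hk with h1 h2
    · exact ⟨h1.le, h1 ▸ Nat.unpair_left_le k⟩
    · have := hx.2 k hk
      omega
  exact fun k j hk hj => (key k hk).1.trans (key j hj).2

theorem eq_of_recolour_eq {n : ℕ} {w w' x x' : ℕ → Bool}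
    (h : recolour n w x = recolour n w' x') : w = w' := by
  funext j
  simpa [recolour] using congrFun h (Nat.pair (n + 1) j)

/-- Two points of one piece agree at bit `n` and on colour `n + 1`, so recolouring keeps their first
difference in place. The bounds 10/9 and 8/9 have ratio 5/4, below 2. -/
theorem abs_quadEmbed_le_recolour {n : ℕ} {b : Bool} (w : ℕ → Bool) {x y : ℕ → Bool}
    (hx : x ∈ colourPiece n b) (hy : y ∈ colourPiece n b) :
    |quadEmbed x - quadEmbed y| ≤ 2 * |quadEmbed (recolour n w x) - quadEmbed (recolour n w y)| := by
  rcases eq_or_ne x y with rfl | hne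
  · simp
  obtain ⟨k, h, hk⟩ := exists_first_ne hne
  have hkn : k ≠ n := by
    rintro rfl
    exact hk (hx.1.trans hy.1.symm)
  have hkc : k.unpair.1 ≠ n + 1 := by
    intro hc
    refine hk ?_
    have h1 : ¬ x k = true := fun hxk => by have := (hx.2 k hxk).1; omega
    have h2 : ¬ y k = true := fun hyk => by have := (hy.2 k hyk).1; omega
    simp_all
  have h1 := (abs_quadEmbed_sub h hk).2
  have h2 := (abs_quadEmbed_sub (x := recolour n w x) (y := recolour n w y) (k := k)
    (fun i hi => by simp [recolour, h i hi]) (by simpa [recolour, hkn, hkc] using hk)).1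
  have hpos : 0 < (1 / 10 : ℝ) ^ Nat.pair 0 k := by positivity
  linarith

/-- The compact set of the theorem. -/
def colourCantor : Set ℝ := quadEmbed '' colourSet

theorem isCompact_colourCantor : IsCompact colourCantor :=
  isClosed_colourSet.isCompact.image continuous_quadEmbed

theorem not_countable_nat_bool : ¬ Countable (ℕ → Bool) := by
  intro h
  obtain ⟨f, hf⟩ := exists_surjective_nat (ℕ → Bool)
  obtain ⟨n, hn⟩ := hf fun n => !f n n
  simpa using congrFun hn n

theorem not_countable_colourCantor : ¬ colourCantor.Countable := by
  intro hc
  have h0 : (fun _ => false : ℕ → Bool) ∈ colourPiece 0 false := by simp [colourPiece]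
  have hinj : Function.Injective fun w => quadEmbed (recolour 0 w fun _ => false) :=
    fun w w' h => eq_of_recolour_eq (quadEmbed_injective h)
  refine not_countable_nat_bool (Set.countable_univ_iff.1 ((hc.preimage_of_injOn
    hinj.injOn).mono fun w _ => ?_))
  exact ⟨_, recolour_mem w h0, rfl⟩

theorem subsingleton_colourCantor_inter_translate {t : ℝ} (ht : t ≠ 0) :
    {p | p ∈ colourCantor ∧ p + t ∈ colourCantor}.Subsingleton := by
  rintro _ ⟨⟨x, -, rfl⟩, y, -, hy⟩ _ ⟨⟨x', -, rfl⟩, y', -, hy'⟩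
  rw [eq_of_quadEmbed_sub_eq (x := x) (y := y) (x' := x') (y' := y') _ (by linarith)]
  rintro rfl
  exact ht (by linarith)

theorem not_isMeasuredBy_gaugeHausdorff {g : ℝ≥0 → ℝ≥0} (hg : IsGauge g) :
    ¬ IsMeasuredBy colourCantor (gaugeHausdorff g) := by
  rintro ⟨-, hpos, hfin⟩
  obtain ⟨⟨n, b⟩, hnb⟩ : ∃ p : ℕ × Bool,
      gaugeHausdorff g (quadEmbed '' colourPiece p.1 p.2) ≠ 0 := by
    by_contra! hall
    refine hpos.ne' (measure_mono_null ?_ (measure_iUnion_null hall))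
    rw [← Set.image_iUnion]
    exact Set.image_mono colourSet_subset_iUnion
  let A : (ℕ → Bool) → Set ℝ := fun w => (fun x => quadEmbed (recolour n w x)) '' colourPiece n b
  have hA : ∀ w, MeasurableSet (A w) := fun w =>
    ((isClosed_colourPiece n b).isCompact.image
      (continuous_quadEmbed.comp (continuous_recolour n w))).measurableSet
  have hdisj : Pairwise (Function.onFun Disjoint A) := fun w w' hww' =>
    Set.disjoint_left.2 <| by
      rintro _ ⟨x, -, rfl⟩ ⟨x', -, h⟩
      exact hww' (eq_of_recolour_eq (quadEmbed_injective h)).symm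
  have hcount := Measure.countable_meas_pos_of_disjoint_iUnion
    (μ := (gaugeHausdorff g).restrict colourCantor) hA hdisj
  have huniv : {w | 0 < (gaugeHausdorff g).restrict colourCantor (A w)} = Set.univ := by
    refine Set.eq_univ_of_forall fun w => ?_
    have hsub : A w ⊆ colourCantor := by
      rintro _ ⟨x, hx, rfl⟩
      exact ⟨_, recolour_mem w hx, rfl⟩
    rw [Set.mem_ofPred_eq, Measure.restrict_eq_self _ hsub, pos_iff_ne_zero]
    exact fun h0 => hnb (gaugeHausdorff_image_eq_zero hg
      (fun x hx y hy => abs_quadEmbed_le_recolour w hx hy) h0)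
  rw [huniv] at hcount
  exact not_countable_nat_bool (Set.countable_univ_iff.1 hcount)

/-! ### Translation invariant measures -/

/-- The sum of all translates of a measure on the line. -/
noncomputable def sumTranslates (ν : Measure ℝ) : Measure ℝ :=
  Measure.sum fun t : ℝ => ν.map fun p => t + p

/-- A translation only permutes the summands. -/
theorem isAddLeftInvariant_sumTranslates (ν : Measure ℝ) :
    (sumTranslates ν).IsAddLeftInvariant := by
  refine ⟨fun s => ?_⟩
  rw [sumTranslates, Measure.map_sum (by fun_prop)]
  refine Measure.ext fun B hB => ?_
  rw [Measure.sum_apply _ hB, Measure.sum_apply _ hB,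
    ← (Equiv.addLeft s).tsum_eq fun t => ν.map (fun p => t + p) B]
  refine tsum_congr fun t => ?_
  rw [Measure.map_map (by fun_prop) (by fun_prop)]
  simp [Function.comp_def, add_assoc]

/-- An uncountable Borel set is Borel isomorphic to the line; transport Lebesgue measure on `[0,
1]`. -/
theorem exists_atomless_probability {K : Set ℝ} (hK : MeasurableSet K) (hc : ¬ K.Countable) :
    ∃ ν : Measure ℝ, ν K = 1 ∧ ν Kᶜ = 0 ∧ NullSingletonClass ν := by
  have := hK.standardBorel
  let e : ℝ ≃ᵐ K := PolishSpace.measurableEquivOfNotCountable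
    (not_countable_iff.2 inferInstance) (by rwa [Set.countable_coe_iff])
  have he : Measurable fun p => (e p : ℝ) := measurable_subtype_coe.comp e.measurable
  have hpre : (fun p => (e p : ℝ)) ⁻¹' K = Set.univ := Set.eq_univ_of_forall fun p => (e p).2
  refine ⟨(volume.restrict (Set.Icc (0 : ℝ) 1)).map fun p => (e p : ℝ), ?_, ?_, ⟨fun p => ?_⟩⟩
  · rw [Measure.map_apply he hK, hpre]
    simp
  · rw [Measure.map_apply he hK.compl, Set.preimage_compl, hpre]
    simp
  · rw [Measure.map_apply he (measurableSet_singleton p)]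
    refine Set.Subsingleton.measure_zero ?_ _
    intro a ha b hb
    exact e.injective (Subtype.ext (ha.trans hb.symm))

/-- A Borel set on the line meeting each of its proper translates in a countable set is measured by
a translation invariant measure. -/
theorem exists_isAddLeftInvariant_isMeasuredBy {K : Set ℝ} (hK : MeasurableSet K)
    (hc : ¬ K.Countable) (hinter : ∀ t ≠ 0, {p | p ∈ K ∧ p + t ∈ K}.Countable) :
    ∃ μ : Measure ℝ, μ.IsAddLeftInvariant ∧ IsMeasuredBy K μ := by
  obtain ⟨ν, h1, h0, hν⟩ := exists_atomless_probability hK hc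
  have hval : sumTranslates ν K = 1 := by
    -- For `t ≠ 0` the overlap is countable, hence null for the atomless `ν`.
    rw [sumTranslates, Measure.sum_apply _ hK, tsum_eq_single 0]
    · simpa using h1
    · intro t ht
      rw [Measure.map_apply (by fun_prop) hK]
      refine measure_mono_null (t := {p | p ∈ K ∧ p + t ∈ K} ∪ Kᶜ) (fun p hp => ?_)
        (measure_union_null ((hinter t ht).measure_zero ν) h0)
      by_cases hpK : p ∈ K
      · exact Or.inl ⟨hpK, by rwa [add_comm]⟩
      · exact Or.inr hpK
  have : IsFiniteMeasure ((sumTranslates ν).restrict K) := ⟨by simp [hval]⟩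
  exact ⟨sumTranslates ν, isAddLeftInvariant_sumTranslates ν, hK, by simp [hval], inferInstance⟩

theorem theorem4p4 :
    ∃ K : Set ℝ, IsCompact K ∧
      (∃ μ : Measure ℝ, μ.IsAddLeftInvariant ∧ IsMeasuredBy K μ) ∧
      ∀ g : ℝ≥0 → ℝ≥0, IsGauge g → ¬ IsMeasuredBy K (gaugeHausdorff g) :=
  ⟨colourCantor, isCompact_colourCantor,
    exists_isAddLeftInvariant_isMeasuredBy isCompact_colourCantor.measurableSet
      not_countable_colourCantor
      fun _ ht => (subsingleton_colourCantor_inter_translate ht).countable,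
    fun _ => not_isMeasuredBy_gaugeHausdorff⟩
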